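/- Let $\mathcal A$ be a unital $C^*$-algebra and let $H_{\mathcal A}=\ell^2(\mathcal A)$ be the standard Hilbert module over $\mathcal A$, i.e. the (left) $\mathcal A$-module of all sequences $x=(x_k)_{k\in\mathbb N}$ in $\mathcal A$ such that $\sum_k x_kx_k^*$ converges in norm, with $\langle x,y\rangle=\sum_k y_kx_k^*$ and $\|x\|=\|\langle x,x\rangle\|^{1/2}$. Let $B^a(H_{\mathcal A})$ be the set of bounded $\mathcal A$-linear operators $F:H_{\mathcal A}\to H_{\mathcal A}$ that are adjointable, i.e. for which there is a bounded $\mathcal A$-linear $F^*$ with $\langle Fx,y\rangle=\langle x,F^*y\rangle$ for all $x,y$. For $F\in B^a(H_{\mathcal A})$ consider closed submodules $M_1,N_1,M_2,N_2$ of $H_{\mathcal A}$ such that $$H_{\mathcal A}=M_1\,\tilde\oplus\,N_1,\qquad H_{\mathcal A}=M_2\,\tilde\oplus\,N_2$$ (direct sums, not necessarily orthogonal) and such that, with respect to these decompositions of the domain and of the range, $F$ has the matrix $$\begin{pmatrix}F_1&0\\0&F_4\end{pmatrix},$$ where $F_1:M_1\to M_2$ is an isomorphism (bounded, $\mathcal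 A$-linear, with bounded inverse). Then $F$ is called * $\mathcal A$-Fredholm, $F\in\mathcal M\Phi(H_{\mathcal A})$, if there are such $M_1,N_1,M_2,N_2$ with both $N_1$ and $N_2$ finitely generated; * upper semi-$\mathcal A$-Fredholm, $F\in\mathcal M\Phi_+(H_{\mathcal A})$, if there are such $M_1,N_1,M_2,N_2$ with $N_1$ finitely generated; * lower semi-$\mathcal A$-Fredholm, $F\in\mathcal M\Phi_-(H_{\mathcal A})$, if there are such $M_1,N_1,M_2,N_2$ with $N_2$ finitely generated. Here a submodule is finitely generated if it is the $\mathcal A$-linear span of a finite subset. Then $$\mathcal M\Phi(H_{\mathcal A})=\mathcal M\Phi_+(H_{\mathcal A})\cap\mathcal M\Phi_-(H_{\mathcal A}).$$ -/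

import Mathlib

open scoped InnerProductSpace

noncomputable section

namespace HilbertCStar

/-- Cauchy-Schwarz inequality for finite sums in a C⋆-algebra. -/
theorem norm_finset_sum_mul_star_le {A : Type*} [CStarAlgebra A] (t : Finset ℕ) (x y : ℕ → A) :
    ‖∑ k ∈ t, y k * star (x k)‖ ≤
      √‖∑ k ∈ t, x k * star (x k)‖ * √‖∑ k ∈ t, y k * star (y k)‖ := by
  let _ : PartialOrder A := CStarAlgebra.spectralOrder A
  have _ : StarOrderedRing A := CStarAlgebra.spectralOrderedRing A
  have h := CStarModule.norm_inner_le (A := A) (WithCStarModule A (t → A))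
    (x := (WithCStarModule.equiv A (t → A)).symm fun k => x k)
    (y := (WithCStarModule.equiv A (t → A)).symm fun k => y k)
  simp only [WithCStarModule.pi_norm, WithCStarModule.pi_inner, WithCStarModule.inner_def,
    WithCStarModule.equiv_symm_pi_apply] at h
  rw [Finset.sum_coe_sort t (fun k => y k * star (x k)),
    Finset.sum_coe_sort t (fun k => x k * star (x k)),
    Finset.sum_coe_sort t (fun k => y k * star (y k))] at h
  exact h

/-- If `∑ xₖ xₖ⋆` and `∑ yₖ yₖ⋆` converge in norm, then so does `∑ yₖ xₖ⋆`. -/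
theorem summable_mul_star {A : Type*} [CStarAlgebra A] {x y : ℕ → A}
    (hx : Summable fun k => x k * star (x k)) (hy : Summable fun k => y k * star (y k)) :
    Summable fun k => y k * star (x k) := by
  rw [summable_iff_vanishing_norm] at hx hy ⊢
  intro ε hε
  obtain ⟨s, hs⟩ := hx ε hε
  obtain ⟨u, hu⟩ := hy ε hε
  refine ⟨s ∪ u, fun t ht => ?_⟩
  rw [Finset.disjoint_union_right] at ht
  refine (norm_finset_sum_mul_star_le t x y).trans_lt ?_
  have h1 := Real.sqrt_lt_sqrt (norm_nonneg _) (hs t ht.1)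
  have h2 := Real.sqrt_lt_sqrt (norm_nonneg _) (hu t ht.2)
  calc _ < √ε * √ε := mul_lt_mul'' h1 h2 (Real.sqrt_nonneg _) (Real.sqrt_nonneg _)
    _ = ε := Real.mul_self_sqrt hε.le

/-- The sequences `(xₖ)` in `A` for which `∑ xₖ xₖ⋆` converges in norm, as a left `A`-submodule of
the module of all sequences. (The terms are positive, so that norm convergence of the series and
unconditional summability are the same thing.) -/
def squareSummable (A : Type*) [CStarAlgebra A] : Submodule A (ℕ → A) where
  carrier := {x | Summable fun k => x k * star (x k)}
  zero_mem' := by simp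
  add_mem' {x y} hx hy := by
    have hx' : Summable fun k => x k * star (x k) := hx
    have hy' : Summable fun k => y k * star (y k) := hy
    have h := ((hx'.add hy').add (summable_mul_star hx' hy')).add (summable_mul_star hy' hx')
    refine h.congr fun k => ?_
    simp only [Pi.add_apply, star_add]
    noncomm_ring
  smul_mem' a x hx := by
    have hx' : Summable fun k => x k * star (x k) := hx
    refine ((hx'.mul_left a).mul_right (star a)).congr fun k => ?_
    simp [mul_assoc]

/-- The standard Hilbert module `H_A = ℓ²(A)` over a unital C⋆-algebra `A`. Following Mathlib's
`CStarModule`, it is a left `A`-module, with inner product `A`-linear in the second variable.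
It is a type of its own because its norm does not induce the topology of pointwise convergence
of sequences. -/
def StandardModule (A : Type*) [CStarAlgebra A] : Type _ := ↥(squareSummable A)

namespace StandardModule

variable {A : Type*} [CStarAlgebra A]

instance : AddCommGroup (StandardModule A) := inferInstanceAs (AddCommGroup ↥(squareSummable A))

instance : Module A (StandardModule A) := inferInstanceAs (Module A ↥(squareSummable A))

instance : Module ℂ (StandardModule A) := inferInstanceAs (Module ℂ ↥(squareSummable A))

instance : IsScalarTower ℂ A (StandardModule A) :=
  inferInstanceAs (IsScalarTower ℂ A ↥(squareSummable A))

/-- The `A`-valued inner product `⟪x, y⟫ = ∑ yₖ xₖ⋆`. -/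
instance : Inner A (StandardModule A) where
  inner x y := ∑' k, y.1 k * star (x.1 k)

/-- The Hilbert module norm `‖x‖ = ‖⟪x, x⟫‖ ^ (1/2)`. -/
instance : Norm (StandardModule A) where
  norm x := √‖⟪x, x⟫_A‖

theorem inner_def (x y : StandardModule A) : ⟪x, y⟫_A = ∑' k, y.1 k * star (x.1 k) := rfl

theorem summable_inner (x y : StandardModule A) : Summable fun k => y.1 k * star (x.1 k) :=
  summable_mul_star x.2 y.2

instance [PartialOrder A] [StarOrderedRing A] : CStarModule A (StandardModule A) where
  inner_add_right {x y z} := by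
    simp only [inner_def]
    rw [← (summable_inner x y).tsum_add (summable_inner x z)]
    exact tsum_congr fun k => add_mul (y.1 k) (z.1 k) _
  inner_self_nonneg {x} := tsum_nonneg fun k => mul_star_self_nonneg (x.1 k)
  inner_self {x} := by
    constructor
    · intro h
      have h0 := (hasSum_zero_iff_of_nonneg fun k => mul_star_self_nonneg (x.1 k)).1
        (h ▸ (summable_inner x x).hasSum :
          HasSum (fun k => x.1 k * star (x.1 k)) 0)
      refine Subtype.ext (funext fun k => ?_)
      exact (CStarRing.mul_star_self_eq_zero_iff (x.1 k)).1 (congrFun h0 k)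
    · rintro rfl
      exact (tsum_congr fun k => zero_mul (star ((0 : StandardModule A).1 k))).trans tsum_zero
  inner_op_smul_right {a x y} := by
    simp only [inner_def]
    rw [← (summable_inner x y).tsum_mul_left]
    exact tsum_congr fun k => mul_assoc a (y.1 k) _
  inner_smul_right_complex {z x y} := by
    simp only [inner_def]
    rw [← (summable_inner x y).tsum_const_smul]
    exact tsum_congr fun k => smul_mul_assoc z (y.1 k) _
  star_inner x y := by
    simp only [inner_def]
    rw [tsum_star]
    simp only [star_mul, star_star]
  norm_eq_sqrt_norm_inner_self x := rfl

theorem normedSpaceCore : NormedSpace.Core ℂ (StandardModule A) := by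
  let _ : PartialOrder A := CStarAlgebra.spectralOrder A
  have _ : StarOrderedRing A := CStarAlgebra.spectralOrderedRing A
  exact CStarModule.normedSpaceCore A

instance : NormedAddCommGroup (StandardModule A) := NormedAddCommGroup.ofCore normedSpaceCore

instance : NormedSpace ℂ (StandardModule A) := NormedSpace.ofCore normedSpaceCore

end StandardModule

section Fredholm

variable {A : Type*} [CStarAlgebra A]

/-- A bounded `A`-linear operator on `H_A` is adjointable if it has an adjoint with respect to the
`A`-valued inner product. -/
def IsAdjointable (F : StandardModule A →L[A] StandardModule A) : Prop :=
  ∃ G : StandardModule A →L[A] StandardModule A, ∀ x y, ⟪F x, y⟫_A = ⟪x, G y⟫_A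

variable (A) in
/-- The set `B^a(H_A)` of bounded adjointable operators on `H_A`. -/
def adjointableOperators : Set (StandardModule A →L[A] StandardModule A) :=
  {F | IsAdjointable F}

/-- `F` has a diagonal matrix `[F₁, 0; 0, F₄]` with respect to direct sum decompositions
`H_A = M₁ ⊕ N₁` of the domain and `H_A = M₂ ⊕ N₂` of the range into closed (not necessarily
orthogonal) submodules, and `F₁ : M₁ → M₂` is an isomorphism (bounded, `A`-linear, with bounded
inverse). -/
structure IsDiagonalDecomposition (F : StandardModule A →L[A] StandardModule A)
    (M₁ N₁ M₂ N₂ : Submodule A (StandardModule A)) : Prop where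
  isClosed_M₁ : IsClosed (M₁ : Set (StandardModule A))
  isClosed_N₁ : IsClosed (N₁ : Set (StandardModule A))
  isClosed_M₂ : IsClosed (M₂ : Set (StandardModule A))
  isClosed_N₂ : IsClosed (N₂ : Set (StandardModule A))
  isCompl_domain : IsCompl M₁ N₁
  isCompl_range : IsCompl M₂ N₂
  iso : ∃ F₁ : M₁ ≃L[A] M₂, ∀ x : M₁, F x = F₁ x
  map_N : ∀ x ∈ N₁, F x ∈ N₂

variable (A) in
/-- `MΦ(H_A)`: the `A`-Fredholm operators. -/
def fredholm : Set (StandardModule A →L[A] StandardModule A) :=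
  {F | F ∈ adjointableOperators A ∧
    ∃ M₁ N₁ M₂ N₂, IsDiagonalDecomposition F M₁ N₁ M₂ N₂ ∧ N₁.FG ∧ N₂.FG}

variable (A) in
/-- `MΦ₊(H_A)`: the upper semi-`A`-Fredholm operators. -/
def upperSemiFredholm : Set (StandardModule A →L[A] StandardModule A) :=
  {F | F ∈ adjointableOperators A ∧
    ∃ M₁ N₁ M₂ N₂, IsDiagonalDecomposition F M₁ N₁ M₂ N₂ ∧ N₁.FG}

variable (A) in
/-- `MΦ₋(H_A)`: the lower semi-`A`-Fredholm operators. -/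
def lowerSemiFredholm : Set (StandardModule A →L[A] StandardModule A) :=
  {F | F ∈ adjointableOperators A ∧
    ∃ M₁ N₁ M₂ N₂, IsDiagonalDecomposition F M₁ N₁ M₂ N₂ ∧ N₂.FG}

end Fredholm

end HilbertCStar

end

/-! Only the inclusion of the intersection in `fredholm` needs an argument, because the two
semi-Fredholm decompositions are unrelated. Both are replaced by a third one, built from a tail
submodule `W` of sequences vanishing below `n`. If `N₁` is closed and finitely generated, vectors of
`W` are almost orthogonal to its generators for large `n`, so `F` is bounded below on `W`
(`exists_tail_bound`). Adjointability then makes the compression of `F⋆F` to `W` invertible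
(`exists_tail_solution`), hence `F(W)` is complemented by its orthogonal complement `V`, and `W` by
`F⁻¹(V)`. Both complements are finitely generated (`mem_fredholm_of_tail_bound`): `W` together with
the first `n` unit vectors spans everything, and the lower decomposition gives `range F + N₂ = H_A`
with its `N₂` finitely generated, so finitely many vectors also suffice to complete `F(W)`. -/

/-! ### Generation of complements, and a surjectivity criterion on Banach spaces. -/

/-- The projection onto `N` along `W` kills `W`, so it already maps `U` onto `N`. -/
theorem Submodule.fg_of_isCompl_of_sup_eq_top {R M : Type*} [Ring R] [AddCommGroup M] [Module R M]
    {W N U : Submodule R M} (h : IsCompl W N) (hU : U.FG) (hWU : W ⊔ U = ⊤) : N.FG := by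
  have h1 : U.map (N.projection W h.symm) = N := by
    have h2 : (W ⊔ U).map (N.projection W h.symm) = N := by
      rw [hWU, Submodule.map_top, Submodule.range_projection]
    rw [Submodule.map_sup] at h2
    have h3 : W.map (N.projection W h.symm) = ⊥ := by
      rw [eq_bot_iff]
      rintro _ ⟨x, hx, rfl⟩
      simpa using hx
    rwa [h3, bot_sup_eq] at h2
  rw [← h1]
  exact hU.map _

/-- Method of continuity: `T + s` is invertible for `s > ‖T‖`, and the uniform lower bound keeps
every inverse that exists of norm at most `c⁻¹`, so invertibility descends to `s = 0` in steps of
length `c / 2`. -/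
theorem ContinuousLinearMap.surjective_of_forall_add_smul_bound {E : Type*} [NormedAddCommGroup E]
    [NormedSpace ℂ E] [CompleteSpace E] (T : E →L[ℂ] E) {c : ℝ} (hc : 0 < c)
    (h : ∀ (s : ℝ), 0 ≤ s → ∀ x, c * ‖x‖ ≤ ‖T x + (s : ℂ) • x‖) : Function.Surjective T := by
  rcases subsingleton_or_nontrivial E with hE | hE
  · exact fun y => ⟨0, Subsingleton.elim _ _⟩
  have key : ∀ s : ℝ, 0 ≤ s → ∀ d : ℝ, 0 ≤ d → d < c → IsUnit (T + ((s + d : ℝ) : ℂ) • 1) →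
      IsUnit (T + ((s : ℝ) : ℂ) • 1) := by
    rintro s hs d hd hdc ⟨u, hu⟩
    have hinv : ‖(↑u⁻¹ : E →L[ℂ] E)‖ ≤ c⁻¹ := by
      refine ContinuousLinearMap.opNorm_le_bound _ (by positivity) fun y => ?_
      have h1 := h (s + d) (by positivity) ((↑u⁻¹ : E →L[ℂ] E) y)
      have h2 : T ((↑u⁻¹ : E →L[ℂ] E) y) + ((s + d : ℝ) : ℂ) • (↑u⁻¹ : E →L[ℂ] E) y = y := by
        have h3 := congrArg (fun S : E →L[ℂ] E => S y) u.mul_inv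
        rw [hu] at h3
        simpa using h3
      rw [h2] at h1
      rwa [inv_mul_eq_div, le_div_iff₀' hc]
    refine (u.ofNearby (T + (s : ℂ) • 1) ?_).isUnit
    have h4 : T + (s : ℂ) • 1 - (u : E →L[ℂ] E) = -((d : ℂ) • 1) := by
      rw [hu]; push_cast; rw [add_smul]; abel
    rw [h4, norm_neg, norm_smul, norm_one, mul_one, Complex.norm_real, Real.norm_of_nonneg hd]
    refine hdc.trans_le ?_
    rw [le_inv_comm₀ hc (Units.norm_pos _)]
    exact hinv
  have hU : ∀ k : ℕ, IsUnit (T + ((k * (c / 2) : ℝ) : ℂ) • 1) → IsUnit T := by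
    intro k
    induction k with
    | zero => simp
    | succ k ih =>
      intro hk
      refine ih (key (k * (c / 2)) (by positivity) (c / 2) (by positivity) (by linarith) ?_)
      convert hk using 4
      push_cast; ring
  obtain ⟨k, hk⟩ := exists_nat_gt (‖T‖ / (c / 2))
  rw [div_lt_iff₀ (by positivity)] at hk
  have hpos : (0 : ℝ) < k * (c / 2) := (norm_nonneg T).trans_lt hk
  have hbig : IsUnit (T + ((k * (c / 2) : ℝ) : ℂ) • 1) := by
    have h1 : ((k * (c / 2) : ℝ) : ℂ) ∈ resolventSet ℂ (-T) := by
      refine spectrum.mem_resolventSet_of_norm_lt ?_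
      rwa [norm_neg, Complex.norm_real, Real.norm_of_nonneg hpos.le]
    rw [spectrum.mem_resolventSet_iff, sub_neg_eq_add, Algebra.algebraMap_eq_smul_one,
      add_comm] at h1
    exact h1
  obtain ⟨u, hu⟩ := hU k hbig
  intro y
  refine ⟨(↑u⁻¹ : E →L[ℂ] E) y, ?_⟩
  rw [← hu]
  exact congrArg (fun S : E →L[ℂ] E => S y) u.mul_inv

noncomputable section

namespace HilbertCStar

/-! ### Inner product calculus and completeness of `H_A`. -/

namespace StandardModule

variable {A : Type*} [CStarAlgebra A]

@[ext]
protected theorem ext {x y : StandardModule A} (h : ∀ k, x.1 k = y.1 k) : x = y :=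
  Subtype.ext (funext h)

@[simp] theorem add_apply (x y : StandardModule A) (k : ℕ) : (x + y).1 k = x.1 k + y.1 k := rfl
@[simp] theorem sub_apply (x y : StandardModule A) (k : ℕ) : (x - y).1 k = x.1 k - y.1 k := rfl
@[simp] theorem smul_apply (a : A) (x : StandardModule A) (k : ℕ) : (a • x).1 k = a * x.1 k := rfl

theorem norm_sq (x : StandardModule A) : ‖x‖ ^ 2 = ‖⟪x, x⟫_A‖ :=
  Real.sq_sqrt (norm_nonneg _)

protected theorem inner_add_right (x y z : StandardModule A) :
    ⟪x, y + z⟫_A = ⟪x, y⟫_A + ⟪x, z⟫_A := by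
  let _ : PartialOrder A := CStarAlgebra.spectralOrder A
  have _ : StarOrderedRing A := CStarAlgebra.spectralOrderedRing A
  exact CStarModule.inner_add_right (A := A) (E := StandardModule A)

protected theorem inner_sub_left (x y z : StandardModule A) :
    ⟪x - y, z⟫_A = ⟪x, z⟫_A - ⟪y, z⟫_A := by
  let _ : PartialOrder A := CStarAlgebra.spectralOrder A
  have _ : StarOrderedRing A := CStarAlgebra.spectralOrderedRing A
  exact CStarModule.inner_sub_left (A := A) (E := StandardModule A)

protected theorem inner_zero_right (x : StandardModule A) : ⟪x, 0⟫_A = 0 := by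
  let _ : PartialOrder A := CStarAlgebra.spectralOrder A
  have _ : StarOrderedRing A := CStarAlgebra.spectralOrderedRing A
  exact CStarModule.inner_zero_right (A := A) (E := StandardModule A)

protected theorem inner_smul_right (a : A) (x y : StandardModule A) :
    ⟪x, a • y⟫_A = a * ⟪x, y⟫_A := by
  let _ : PartialOrder A := CStarAlgebra.spectralOrder A
  have _ : StarOrderedRing A := CStarAlgebra.spectralOrderedRing A
  exact CStarModule.inner_op_smul_right (A := A) (E := StandardModule A)

protected theorem inner_smul_left (a : A) (x y : StandardModule A) :
    ⟪a • x, y⟫_A = ⟪x, y⟫_A * star a := by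
  let _ : PartialOrder A := CStarAlgebra.spectralOrder A
  have _ : StarOrderedRing A := CStarAlgebra.spectralOrderedRing A
  exact CStarModule.inner_op_smul_left (A := A) (E := StandardModule A)

theorem inner_smul_complex_right (z : ℂ) (x y : StandardModule A) :
    ⟪x, z • y⟫_A = z • ⟪x, y⟫_A := by
  let _ : PartialOrder A := CStarAlgebra.spectralOrder A
  have _ : StarOrderedRing A := CStarAlgebra.spectralOrderedRing A
  exact CStarModule.inner_smul_right_complex (A := A) (E := StandardModule A)

protected theorem inner_sum_right {ι : Type*} (s : Finset ι) (x : StandardModule A)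
    (y : ι → StandardModule A) : ⟪x, ∑ i ∈ s, y i⟫_A = ∑ i ∈ s, ⟪x, y i⟫_A := by
  let _ : PartialOrder A := CStarAlgebra.spectralOrder A
  have _ : StarOrderedRing A := CStarAlgebra.spectralOrderedRing A
  exact CStarModule.inner_sum_right (A := A) (E := StandardModule A)

theorem inner_self_nonneg [PartialOrder A] [StarOrderedRing A] (x : StandardModule A) :
    0 ≤ ⟪x, x⟫_A :=
  CStarModule.inner_self_nonneg (A := A) (E := StandardModule A)

protected theorem norm_inner_le (x y : StandardModule A) : ‖⟪x, y⟫_A‖ ≤ ‖x‖ * ‖y‖ := by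
  let _ : PartialOrder A := CStarAlgebra.spectralOrder A
  have _ : StarOrderedRing A := CStarAlgebra.spectralOrderedRing A
  exact CStarModule.norm_inner_le (StandardModule A)

protected theorem norm_smul_le (a : A) (x : StandardModule A) : ‖a • x‖ ≤ ‖a‖ * ‖x‖ := by
  have h : ‖a • x‖ ^ 2 ≤ (‖a‖ * ‖x‖) ^ 2 := by
    rw [norm_sq, StandardModule.inner_smul_right, StandardModule.inner_smul_left, mul_pow, norm_sq]
    refine (norm_mul_le _ _).trans ?_
    refine (mul_le_mul_of_nonneg_left (norm_mul_le _ _) (norm_nonneg _)).trans ?_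
    rw [norm_star]
    exact le_of_eq (by ring)
  exact (abs_le_of_sq_le_sq' h (by positivity)).2

/-- The parallelogram identity, with the positive terms `(u - v)(u - v)⋆` dropped. -/
theorem norm_sum_mul_star_add_le (t : Finset ℕ) (u v : ℕ → A) :
    ‖∑ k ∈ t, (u k + v k) * star (u k + v k)‖ ≤
      2 * (‖∑ k ∈ t, u k * star (u k)‖ + ‖∑ k ∈ t, v k * star (v k)‖) := by
  let _ : PartialOrder A := CStarAlgebra.spectralOrder A
  have _ : StarOrderedRing A := CStarAlgebra.spectralOrderedRing A
  have h : ∑ k ∈ t, (u k + v k) * star (u k + v k) ≤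
      (∑ k ∈ t, u k * star (u k) + ∑ k ∈ t, v k * star (v k)) +
        (∑ k ∈ t, u k * star (u k) + ∑ k ∈ t, v k * star (v k)) := by
    simp only [← Finset.sum_add_distrib]
    refine Finset.sum_le_sum fun k _ => ?_
    have h1 := mul_star_self_nonneg (u k - v k)
    rw [← sub_nonneg]
    convert h1 using 1
    simp only [star_add, star_sub]
    noncomm_ring
  refine (CStarAlgebra.norm_le_norm_of_nonneg_of_le
    (Finset.sum_nonneg fun k _ => mul_star_self_nonneg _) h).trans ?_
  rw [two_mul]
  exact (norm_add_le _ _).trans (add_le_add (norm_add_le _ _) (norm_add_le _ _))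

theorem norm_sum_mul_star_le (x : StandardModule A) (t : Finset ℕ) :
    ‖∑ k ∈ t, x.1 k * star (x.1 k)‖ ≤ ‖x‖ ^ 2 := by
  let _ : PartialOrder A := CStarAlgebra.spectralOrder A
  have _ : StarOrderedRing A := CStarAlgebra.spectralOrderedRing A
  rw [norm_sq]
  exact CStarAlgebra.norm_le_norm_of_nonneg_of_le
    (Finset.sum_nonneg fun k _ => mul_star_self_nonneg _)
    ((summable_inner x x).sum_le_tsum t fun k _ => mul_star_self_nonneg _)

theorem norm_apply_le (x : StandardModule A) (k : ℕ) : ‖x.1 k‖ ≤ ‖x‖ := by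
  have h := norm_sum_mul_star_le x {k}
  rw [Finset.sum_singleton, CStarRing.norm_self_mul_star] at h
  exact (abs_le_of_sq_le_sq' (by nlinarith) (norm_nonneg x)).2

instance : CompleteSpace (StandardModule A) := by
  refine Metric.complete_of_cauchySeq_tendsto fun u hu => ?_
  have hcoord : ∀ k, ∃ a, Filter.Tendsto (fun j => (u j).1 k) Filter.atTop (nhds a) := by
    intro k
    refine cauchySeq_tendsto_of_complete ?_
    rw [Metric.cauchySeq_iff'] at hu ⊢
    intro ε hε
    obtain ⟨N, hN⟩ := hu ε hε
    refine ⟨N, fun n hn => lt_of_le_of_lt ?_ (hN n hn)⟩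
    rw [dist_eq_norm, dist_eq_norm]
    exact norm_apply_le (u n - u N) k
  choose x hx using hcoord
  -- The bound is uniform in the finite set `t`; this gives both the square summability of the
  -- coordinatewise limit and the convergence in norm.
  have hbound : ∀ ε > 0, ∃ N, ∀ n ≥ N, ∀ t : Finset ℕ,
      ‖∑ k ∈ t, (x k - (u n).1 k) * star (x k - (u n).1 k)‖ ≤ ε ^ 2 := by
    intro ε hε
    rw [Metric.cauchySeq_iff] at hu
    obtain ⟨N, hN⟩ := hu ε hε
    refine ⟨N, fun n hn t => ?_⟩
    have hlim : Filter.Tendsto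
        (fun j => ‖∑ k ∈ t, ((u j).1 k - (u n).1 k) * star ((u j).1 k - (u n).1 k)‖)
        Filter.atTop (nhds ‖∑ k ∈ t, (x k - (u n).1 k) * star (x k - (u n).1 k)‖) :=
      (tendsto_finsetSum t fun k _ =>
        ((hx k).sub_const _).mul ((hx k).sub_const _).star).norm
    refine le_of_tendsto hlim (Filter.eventually_atTop.2 ⟨N, fun j hj => ?_⟩)
    refine (norm_sum_mul_star_le (u j - u n) t).trans ?_
    have := hN j hj n hn
    rw [dist_eq_norm] at this
    exact pow_le_pow_left₀ (norm_nonneg _) this.le 2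
  have hsum : Summable fun k => x k * star (x k) := by
    rw [summable_iff_vanishing_norm]
    intro ε hε
    obtain ⟨N, hN⟩ := hbound (√(ε / 8)) (by positivity)
    obtain ⟨s, hs⟩ := summable_iff_vanishing_norm.1 (u N).2 (ε / 8) (by positivity)
    refine ⟨s, fun t ht => ?_⟩
    have h1 := norm_sum_mul_star_add_le t (fun k => x k - (u N).1 k) (u N).1
    simp only [sub_add_cancel] at h1
    have h2 := hN N le_rfl t
    rw [Real.sq_sqrt (by positivity)] at h2
    have h3 := hs t ht
    linarith
  let y : StandardModule A := ⟨x, hsum⟩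
  refine ⟨y, Metric.tendsto_atTop.2 fun ε hε => ?_⟩
  obtain ⟨N, hN⟩ := hbound (ε / 2) (by positivity)
  refine ⟨N, fun n hn => ?_⟩
  rw [dist_comm, dist_eq_norm]
  have h1 : ‖y - u n‖ ^ 2 ≤ (ε / 2) ^ 2 := by
    rw [norm_sq]
    exact le_of_tendsto (summable_inner (y - u n) (y - u n)).hasSum.norm
      (Filter.Eventually.of_forall fun t => hN n hn t)
  have h2 := (abs_le_of_sq_le_sq' h1 (by positivity)).2
  linarith

/-! ### Tail projections and unit vectors. -/

/-- The projection of `H_A` onto the sequences vanishing at the indices below `n`. -/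
def tail (n : ℕ) : StandardModule A →ₗ[A] StandardModule A where
  toFun x := ⟨fun k => if k < n then 0 else x.1 k, by
    refine (Summable.indicator (summable_inner x x) {k | ¬ k < n}).congr fun k => ?_
    by_cases h : k < n <;> simp [h, Set.indicator]⟩
  map_add' x y := by
    refine Subtype.ext (funext fun k => ?_)
    change (if k < n then 0 else x.1 k + y.1 k) =
      (if k < n then 0 else x.1 k) + (if k < n then 0 else y.1 k)
    by_cases h : k < n <;> simp [h]
  map_smul' a x := by
    refine Subtype.ext (funext fun k => ?_)
    change (if k < n then 0 else a * x.1 k) = a * (if k < n then 0 else x.1 k)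
    by_cases h : k < n <;> simp [h]

theorem tail_apply (n : ℕ) (x : StandardModule A) (k : ℕ) :
    (tail n x).1 k = if k < n then 0 else x.1 k := rfl

theorem tail_tail (n : ℕ) (x : StandardModule A) : tail n (tail n x) = tail n x := by
  ext k
  by_cases h : k < n <;> simp [tail_apply, h]

theorem inner_tail_left (n : ℕ) (x y : StandardModule A) : ⟪tail n x, y⟫_A = ⟪x, tail n y⟫_A := by
  simp only [inner_def, tail_apply]
  refine tsum_congr fun k => ?_
  by_cases h : k < n <;> simp [h]

theorem norm_tail_le (n : ℕ) (x : StandardModule A) : ‖tail n x‖ ≤ ‖x‖ := by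
  have h : ‖tail n x‖ ^ 2 ≤ ‖x‖ * ‖tail n x‖ := by
    rw [norm_sq, inner_tail_left, tail_tail]
    exact StandardModule.norm_inner_le _ _
  rcases (norm_nonneg (tail n x)).eq_or_lt with h0 | h0
  · rw [← h0]; exact norm_nonneg x
  · nlinarith

theorem continuous_tail (n : ℕ) : Continuous (tail n : StandardModule A →ₗ[A] StandardModule A) :=
  AddMonoidHomClass.continuous_of_bound (tail n) 1 fun x => by simpa using norm_tail_le n x

theorem tendsto_tail (x : StandardModule A) :
    Filter.Tendsto (fun n => ‖tail n x‖) Filter.atTop (nhds 0) := by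
  have h : ∀ n, ‖tail n x‖ = √‖∑' k, x.1 (k + n) * star (x.1 (k + n))‖ := by
    intro n
    rw [← Real.sqrt_sq (norm_nonneg (tail n x)), norm_sq, inner_def,
      ← (summable_inner (tail n x) (tail n x)).sum_add_tsum_nat_add n,
      Finset.sum_eq_zero, zero_add]
    · simp [tail_apply]
    · intro k hk
      simp [tail_apply, Finset.mem_range.1 hk]
  simp only [h]
  have h2 := (tendsto_sum_nat_add fun k => x.1 k * star (x.1 k)).norm.sqrt
  simpa using h2

/-- The sequence with entry `1` at `k` and `0` elsewhere. -/
def single (k : ℕ) : StandardModule A :=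
  ⟨Pi.single k 1, summable_of_ne_finset_zero (s := {k}) fun j hj => by
    simp [Pi.single_eq_of_ne (Finset.notMem_singleton.1 hj)]⟩

theorem single_apply (j k : ℕ) :
    (single j : StandardModule A).1 k = (Pi.single j 1 : ℕ → A) k := rfl

theorem sub_tail_mem_span (n : ℕ) (x : StandardModule A) :
    x - tail n x ∈ Submodule.span A (single '' Set.Iio n) := by
  induction n with
  | zero =>
    have : x - tail 0 x = 0 := by
      ext k
      simp [tail_apply]; rfl
    rw [this]; exact zero_mem _
  | succ n ih =>
    have h : x - tail (n + 1) x = (x - tail n x) + x.1 n • single n := by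
      ext k
      rcases lt_trichotomy k n with hk | rfl | hk
      · simp [tail_apply, single_apply, hk, hk.trans (Nat.lt_succ_self n), hk.ne]
      · simp [tail_apply, single_apply]
      · simp [tail_apply, single_apply, hk.not_gt, hk.ne', Nat.not_lt.2 (Nat.succ_le_of_lt hk)]
    rw [h]
    refine add_mem (Submodule.span_mono ?_ ih) (Submodule.smul_mem _ _ (Submodule.subset_span ?_))
    · exact Set.image_mono (Set.Iio_subset_Iio (Nat.le_succ n))
    · exact ⟨n, Nat.lt_succ_self n, rfl⟩

end StandardModule

open StandardModule

variable {A : Type*} [CStarAlgebra A]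

/-! ### Lower bound for an upper semi-Fredholm operator on a tail. -/

theorem exists_norm_le_of_isCompl {M N : Submodule A (StandardModule A)}
    (hM : IsClosed (M : Set (StandardModule A))) (hN : IsClosed (N : Set (StandardModule A)))
    (h : IsCompl M N) : ∃ C : ℝ, 0 ≤ C ∧ ∀ m ∈ M, ∀ n ∈ N, ‖m‖ ≤ C * ‖m + n‖ := by
  have hc : IsCompl (M.restrictScalars ℂ) (N.restrictScalars ℂ) := by
    constructor
    · rw [Submodule.disjoint_def]
      exact fun x hx hx' => Submodule.disjoint_def.1 h.disjoint x hx hx'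
    · rw [codisjoint_iff, eq_top_iff]
      intro x _
      obtain ⟨m, hm, n, hn, rfl⟩ := Submodule.mem_sup.1 (h.sup_eq_top ▸ Submodule.mem_top :
        x ∈ M ⊔ N)
      exact Submodule.mem_sup.2 ⟨m, hm, n, hn, rfl⟩
  have ht := Submodule.IsCompl.isTopCompl_of_isClosed hc hM hN
  refine ⟨‖Submodule.projectionOntoL _ _ ht‖, ContinuousLinearMap.opNorm_nonneg _,
    fun m hm n hn => ?_⟩
  have h1 := (Submodule.projectionOntoL _ _ ht).le_opNorm (m + n)
  have h2 : Submodule.projectionOntoL _ _ ht (m + n) = (⟨m, hm⟩ : M.restrictScalars ℂ) := by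
    change Submodule.projectionOnto _ _ hc (m + n) = _
    rw [map_add, Submodule.projectionOnto_apply_of_mem_left hc hm,
      (Submodule.projectionOnto_apply_eq_zero_iff hc).2 hn, add_zero]
  rw [h2] at h1
  exact h1

/-- By the open mapping theorem for `Aʳ → N`, write `x = ∑ aᵢ uᵢ` with `‖a‖ ≤ C ‖x‖`; expand `⟪x, x⟫
= ∑ aᵢ ⟪x, uᵢ⟫` and divide by `‖x‖`. -/
theorem exists_norm_le_of_fg {N : Submodule A (StandardModule A)}
    (hN : IsClosed (N : Set (StandardModule A))) (hfg : N.FG) :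
    ∃ (r : ℕ) (u : Fin r → StandardModule A) (C : ℝ), 0 ≤ C ∧
      ∀ x ∈ N, ‖x‖ ≤ C * ∑ i, ‖⟪x, u i⟫_A‖ := by
  obtain ⟨r, u, hu⟩ := Submodule.fg_iff_exists_fin_generating_family.1 hfg
  let φ : (Fin r → A) →ₗ[ℂ] StandardModule A :=
    { toFun := fun a => ∑ i, a i • u i
      map_add' := fun a b => by simp only [Pi.add_apply, add_smul, Finset.sum_add_distrib]
      map_smul' := fun z a => by
        simp only [Pi.smul_apply, smul_assoc, Finset.smul_sum, RingHom.id_apply] }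
  have hmem : ∀ a, φ a ∈ N := by
    intro a
    change ∑ i, a i • u i ∈ N
    rw [← hu]
    exact Submodule.sum_mem _ fun i _ =>
      Submodule.smul_mem _ _ (Submodule.subset_span (Set.mem_range_self i))
  let ψ : (Fin r → A) →ₗ[ℂ] N.restrictScalars ℂ := φ.codRestrict _ hmem
  let Ψ : (Fin r → A) →L[ℂ] N.restrictScalars ℂ := ψ.mkContinuous (∑ i, ‖u i‖) fun a => by
    change ‖∑ i, a i • u i‖ ≤ _
    rw [Finset.sum_mul]
    refine norm_sum_le_of_le _ fun i _ => (StandardModule.norm_smul_le _ _).trans ?_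
    rw [mul_comm]
    exact mul_le_mul_of_nonneg_left (norm_le_pi_norm a i) (norm_nonneg _)
  have hsurj : Function.Surjective Ψ := by
    rintro ⟨x, hx⟩
    have hx' : x ∈ N := hx
    rw [← hu, Submodule.mem_span_range_iff_exists_fun] at hx'
    obtain ⟨a, ha⟩ := hx'
    exact ⟨a, Subtype.ext ha⟩
  have : CompleteSpace (N.restrictScalars ℂ) := hN.completeSpace_coe
  obtain ⟨C, hC, h⟩ := Ψ.exists_preimage_norm_le hsurj
  refine ⟨r, u, C, hC.le, fun x hx => ?_⟩
  obtain ⟨a, ha, hna⟩ := h ⟨x, hx⟩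
  have hxa : x = ∑ i, a i • u i := (congrArg Subtype.val ha).symm
  have hna' : ‖a‖ ≤ C * ‖x‖ := hna
  have h1 : ‖x‖ ^ 2 ≤ (C * ‖x‖) * ∑ i, ‖⟪x, u i⟫_A‖ := by
    have h2 : ⟪x, x⟫_A = ∑ i, a i * ⟪x, u i⟫_A := by
      conv_lhs => rw [hxa, StandardModule.inner_sum_right, ← hxa]
      simp only [StandardModule.inner_smul_right]
    rw [norm_sq, h2, Finset.mul_sum]
    refine norm_sum_le_of_le _ fun i _ => (norm_mul_le _ _).trans ?_
    exact mul_le_mul_of_nonneg_right ((norm_le_pi_norm a i).trans hna') (norm_nonneg _)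
  rcases (norm_nonneg x).eq_or_lt with h0 | h0
  · rw [← h0]; positivity
  · nlinarith

/-- Split a tail vector as `y = p + q` along `M₁`, `N₁`. The invertible corner controls `p` by `F
y`. The generators `uᵢ` of `N₁` control `q = y - p`, and `y` pairs with them only through their
tails, which are small. -/
theorem IsDiagonalDecomposition.exists_tail_bound
    {F : StandardModule A →L[A] StandardModule A} {M₁ N₁ M₂ N₂ : Submodule A (StandardModule A)}
    (h : IsDiagonalDecomposition F M₁ N₁ M₂ N₂) (hfg : N₁.FG) :
    ∃ (n : ℕ) (C : ℝ), 0 ≤ C ∧ ∀ x, ‖tail n x‖ ≤ C * ‖F (tail n x)‖ := by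
  obtain ⟨F₁, hF₁⟩ := h.iso
  obtain ⟨C₂, hC₂, h₂⟩ := exists_norm_le_of_isCompl h.isClosed_M₂ h.isClosed_N₂ h.isCompl_range
  obtain ⟨r, u, C, hC, hu⟩ := exists_norm_le_of_fg h.isClosed_N₁ hfg
  let K : M₂ →L[ℂ] M₁ := (F₁.symm : M₂ →L[A] M₁).restrictScalars ℂ
  have hm : ∀ m ∈ M₁, ∀ n ∈ N₁, ‖m‖ ≤ ‖K‖ * C₂ * ‖F (m + n)‖ := by
    intro m hm n hn
    have h1 := K.le_opNorm (F₁ ⟨m, hm⟩)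
    have h2 : K (F₁ ⟨m, hm⟩) = ⟨m, hm⟩ := F₁.symm_apply_apply _
    rw [h2] at h1
    have h3 : ‖F₁ ⟨m, hm⟩‖ = ‖F m‖ := congrArg norm (hF₁ ⟨m, hm⟩).symm
    rw [h3] at h1
    have h4 := h₂ (F m) (by rw [hF₁ ⟨m, hm⟩]; exact (F₁ _).2) (F n) (h.map_N n hn)
    rw [← map_add] at h4
    rw [mul_assoc]
    exact h1.trans (mul_le_mul_of_nonneg_left h4 K.opNorm_nonneg)
  have hlim : Filter.Tendsto (fun n => C * ∑ i, ‖tail n (u i)‖) Filter.atTop (nhds 0) := by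
    simpa using (tendsto_finsetSum Finset.univ fun i _ => tendsto_tail (u i)).const_mul C
  -- The threshold `1 / 2` lets the `‖y‖` term be absorbed: `‖y‖ ≤ ‖y‖ / 2 + (1 + S) ‖p‖`.
  obtain ⟨n, hn⟩ := (hlim.eventually_lt_const (show (0 : ℝ) < 1 / 2 by norm_num)).exists
  set S := C * ∑ i, ‖u i‖ with hS
  have hS0 : 0 ≤ S := by positivity
  refine ⟨n, 2 * ((1 + S) * (‖K‖ * C₂)), by positivity, fun x => ?_⟩
  set y := tail n x with hy
  obtain ⟨p, hp, q, hq, hpq⟩ := Submodule.mem_sup.1 (h.isCompl_domain.sup_eq_top ▸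
    Submodule.mem_top : y ∈ M₁ ⊔ N₁)
  have hp' := hm p hp q hq
  rw [hpq] at hp'
  have hq' : ‖q‖ ≤ 1 / 2 * ‖y‖ + S * ‖p‖ := by
    have h1 : ∀ i, ‖⟪q, u i⟫_A‖ ≤ ‖y‖ * ‖tail n (u i)‖ + ‖p‖ * ‖u i‖ := by
      intro i
      have h2 : ⟪q, u i⟫_A = ⟪y, tail n (u i)⟫_A - ⟪p, u i⟫_A := by
        rw [← inner_tail_left, hy, tail_tail, ← hy,
          ← StandardModule.inner_sub_left, ← hpq, add_sub_cancel_left]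
      rw [h2]
      exact (norm_sub_le _ _).trans (add_le_add (StandardModule.norm_inner_le _ _)
        (StandardModule.norm_inner_le _ _))
    calc ‖q‖ ≤ C * ∑ i, ‖⟪q, u i⟫_A‖ := hu q hq
      _ ≤ C * ∑ i, (‖y‖ * ‖tail n (u i)‖ + ‖p‖ * ‖u i‖) :=
        mul_le_mul_of_nonneg_left (Finset.sum_le_sum fun i _ => h1 i) hC
      _ = (C * ∑ i, ‖tail n (u i)‖) * ‖y‖ + S * ‖p‖ := by
        rw [Finset.sum_add_distrib, ← Finset.mul_sum, ← Finset.mul_sum, hS]; ring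
      _ ≤ _ := by gcongr
  have hy' : ‖y‖ ≤ ‖p‖ + ‖q‖ := hpq ▸ norm_add_le p q
  have : (1 + S) * ‖p‖ ≤ (1 + S) * (‖K‖ * C₂ * ‖F y‖) := by gcongr
  linarith

/-! ### Orthogonal complement of the image of a tail, and the Fredholm decomposition. -/

/-- This is the normal equation for projecting `y` orthogonally onto `F(W)`. It is solvable because
the compression of `F⋆F` to the tail is positive and bounded below. -/
theorem exists_tail_solution {F G : StandardModule A →L[A] StandardModule A}
    (hFG : ∀ x y, ⟪F x, y⟫_A = ⟪x, G y⟫_A) {n : ℕ} {C : ℝ} (hC : 0 ≤ C)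
    (hb : ∀ x, ‖tail n x‖ ≤ C * ‖F (tail n x)‖) (y : StandardModule A) :
    ∃ x, tail n (G (F (tail n x))) = tail n (G y) := by
  let _ : PartialOrder A := CStarAlgebra.spectralOrder A
  have _ : StarOrderedRing A := CStarAlgebra.spectralOrderedRing A
  let e : StandardModule A →L[A] StandardModule A := ⟨tail n, continuous_tail n⟩
  -- Adding `1 - e` extends the compression by the identity on the complement of the tail, so that
  -- `T` is coercive on all of `H_A`.
  let T : StandardModule A →L[A] StandardModule A :=
    e ∘L G ∘L F ∘L e + (ContinuousLinearMap.id A _ - e)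
  have hT : ∀ x, T x = tail n (G (F (tail n x))) + (x - tail n x) := fun x => rfl
  have hinner : ∀ x, ⟪x, T x⟫_A =
      ⟪F (tail n x), F (tail n x)⟫_A + ⟪x - tail n x, x - tail n x⟫_A := by
    intro x
    rw [hT, StandardModule.inner_add_right, ← inner_tail_left, hFG,
      StandardModule.inner_sub_left x (tail n x), inner_tail_left n x (x - tail n x), map_sub,
      tail_tail, sub_self, StandardModule.inner_zero_right, sub_zero]
  have hsurj : Function.Surjective (T.restrictScalars ℂ) := by
    refine ContinuousLinearMap.surjective_of_forall_add_smul_bound _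
      (c := ((C + 1) ^ 2)⁻¹) (by positivity) fun s hs x => ?_
    rw [ContinuousLinearMap.coe_restrictScalars']
    set z := T x + (s : ℂ) • x with hz
    have h1 : ⟪x, z⟫_A = ⟪F (tail n x), F (tail n x)⟫_A +
        ⟪x - tail n x, x - tail n x⟫_A + s • ⟪x, x⟫_A := by
      rw [hz, StandardModule.inner_add_right, hinner, inner_smul_complex_right, Complex.coe_smul]
    have h0 : 0 ≤ s • ⟪x, x⟫_A := smul_nonneg hs (inner_self_nonneg x)
    have hF0 := inner_self_nonneg (F (tail n x))
    have hp0 := inner_self_nonneg (x - tail n x)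
    -- Each of the three positive summands of `⟪x, z⟫` is dominated by the sum, hence in norm by
    -- `‖x‖ ‖z‖`.
    have hM : ‖⟪x, z⟫_A‖ ≤ ‖x‖ * ‖z‖ := StandardModule.norm_inner_le x z
    have h2 : ‖F (tail n x)‖ ^ 2 ≤ ‖x‖ * ‖z‖ := by
      rw [norm_sq]
      refine (CStarAlgebra.norm_le_norm_of_nonneg_of_le hF0 ?_).trans hM
      rw [h1, add_assoc]
      exact le_add_of_nonneg_right (add_nonneg hp0 h0)
    have h3 : ‖x - tail n x‖ ^ 2 ≤ ‖x‖ * ‖z‖ := by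
      rw [norm_sq]
      refine (CStarAlgebra.norm_le_norm_of_nonneg_of_le hp0 ?_).trans hM
      rw [h1, add_right_comm]
      exact le_add_of_nonneg_left (add_nonneg hF0 h0)
    have h4 : ‖x‖ ≤ (C + 1) * √(‖x‖ * ‖z‖) := by
      have h5 := Real.le_sqrt_of_sq_le h2
      have h6 := Real.le_sqrt_of_sq_le h3
      calc ‖x‖ = ‖tail n x + (x - tail n x)‖ := by rw [add_sub_cancel]
        _ ≤ ‖tail n x‖ + ‖x - tail n x‖ := norm_add_le _ _
        _ ≤ C * √(‖x‖ * ‖z‖) + √(‖x‖ * ‖z‖) :=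
          add_le_add ((hb x).trans (mul_le_mul_of_nonneg_left h5 hC)) h6
        _ = _ := by ring
    have h7 : ‖x‖ ^ 2 ≤ (C + 1) ^ 2 * (‖x‖ * ‖z‖) := by
      rw [← Real.sq_sqrt (show 0 ≤ ‖x‖ * ‖z‖ by positivity), ← mul_pow]
      exact pow_le_pow_left₀ (norm_nonneg _) h4 2
    rw [inv_mul_le_iff₀ (by positivity)]
    rcases (norm_nonneg x).eq_or_lt with h8 | h8
    · rw [← h8]; positivity
    · nlinarith
  obtain ⟨x, hx⟩ := hsurj (tail n (G y))
  refine ⟨x, ?_⟩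
  have h1 := congrArg (tail n) (show T x = tail n (G y) from hx)
  rwa [hT, map_add, map_sub, tail_tail, tail_tail, tail_tail, sub_self, add_zero] at h1

theorem mem_fredholm_of_tail_bound {F : StandardModule A →L[A] StandardModule A}
    (hF : IsAdjointable F) {n : ℕ} {C : ℝ} (hC : 0 ≤ C)
    (hb : ∀ x, ‖tail n x‖ ≤ C * ‖F (tail n x)‖) {U : Submodule A (StandardModule A)}
    (hU : U.FG) (hFU : LinearMap.range (F : StandardModule A →ₗ[A] StandardModule A) ⊔ U = ⊤) :
    F ∈ fredholm A := by
  obtain ⟨G, hFG⟩ := id hF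
  let f : StandardModule A →ₗ[A] StandardModule A := F
  let W : Submodule A (StandardModule A) := LinearMap.range (tail n)
  -- The orthogonal complement of `F(W)`: `⟪F (tail n x), v⟫ = ⟪x, tail n (G v)⟫`.
  let V : Submodule A (StandardModule A) :=
    LinearMap.ker (tail n ∘ₗ (G : StandardModule A →ₗ[A] StandardModule A))
  let P : Submodule A (StandardModule A) := Submodule.span A (single '' Set.Iio n)
  have hP : P.FG := Submodule.fg_span ((Set.finite_Iio n).image _)
  have hWP : W ⊔ P = ⊤ := by
    rw [eq_top_iff]
    intro x _
    rw [← add_sub_cancel (tail n x) x]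
    exact Submodule.add_mem_sup ⟨x, rfl⟩ (sub_tail_mem_span n x)
  have hbW : ∀ x ∈ W, ‖x‖ ≤ C * ‖F x‖ := by
    rintro _ ⟨x, rfl⟩
    exact hb x
  have hdisj : Disjoint (W.map f) V := by
    rw [Submodule.disjoint_def]
    rintro _ ⟨_, ⟨x, rfl⟩, rfl⟩ hV
    have hV' : tail n (G (F (tail n x))) = 0 := hV
    have h1 : ‖F (tail n x)‖ ^ 2 = 0 := by
      rw [norm_sq, hFG, inner_tail_left, hV', StandardModule.inner_zero_right, norm_zero]
    exact norm_eq_zero.1 (pow_eq_zero_iff two_ne_zero |>.1 h1)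
  have hsup : W.map f ⊔ V = ⊤ := by
    rw [eq_top_iff]
    intro y _
    obtain ⟨x, hx⟩ := exists_tail_solution hFG hC hb y
    rw [← add_sub_cancel (F (tail n x)) y]
    refine Submodule.add_mem_sup ⟨_, ⟨x, rfl⟩, rfl⟩ ?_
    change tail n (G (y - F (tail n x))) = 0
    rw [map_sub, map_sub, hx, sub_self]
  have hV : IsCompl (W.map f) V := ⟨hdisj, codisjoint_iff.2 hsup⟩
  have hW : IsCompl W (V.comap f) := by
    constructor
    · rw [Submodule.disjoint_def]
      intro x hx hx'
      have h1 : F x = 0 := Submodule.disjoint_def.1 hdisj _ ⟨x, hx, rfl⟩ hx'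
      have h2 := hbW x hx
      rw [h1, norm_zero, mul_zero] at h2
      exact norm_le_zero_iff.1 h2
    · rw [codisjoint_iff, eq_top_iff]
      intro x _
      obtain ⟨_, ⟨w, hw, rfl⟩, v, hv, hwv⟩ := Submodule.mem_sup.1 (hsup ▸
        Submodule.mem_top : F x ∈ W.map f ⊔ V)
      rw [← add_sub_cancel w x]
      refine Submodule.add_mem_sup hw ?_
      change F (x - w) ∈ V
      rw [map_sub, ← hwv]
      simpa [f] using hv
  have hWclosed : IsClosed (W : Set (StandardModule A)) := by
    have : (W : Set (StandardModule A)) = {x | tail n x = x} := by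
      ext x
      constructor
      · rintro ⟨z, rfl⟩
        exact tail_tail n z
      · exact fun hx => ⟨x, hx⟩
    rw [this]
    exact isClosed_eq (continuous_tail n) continuous_id
  have hVclosed : IsClosed (V : Set (StandardModule A)) :=
    isClosed_eq ((continuous_tail n).comp G.continuous) continuous_const
  have hinj : ∀ x y : W, F x = F y → x = y := by
    intro x y hxy
    have h2 := hbW (x - y : W) (x - y : W).2
    rw [Submodule.coe_sub, map_sub, hxy, sub_self, norm_zero, mul_zero] at h2
    exact sub_eq_zero.1 (Subtype.ext (norm_le_zero_iff.1 h2))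
  let E : W ≃ₗ[A] W.map f := LinearEquiv.ofBijective (f.submoduleMap W)
    ⟨fun x y hxy => hinj x y (congrArg Subtype.val hxy), f.submoduleMap_surjective W⟩
  have hE : ∀ x, ((E x : W.map f) : StandardModule A) = F x := fun x => rfl
  let E' : W ≃L[A] W.map f :=
    { E with
      continuous_toFun := (F.continuous.comp continuous_subtype_val).subtype_mk _
      continuous_invFun := by
        refine AddMonoidHomClass.continuous_of_bound E.symm C fun z => ?_
        have h1 := hbW (E.symm z) (E.symm z).2
        rwa [← hE, E.apply_symm_apply] at h1 }
  -- The image of a complete space under a map bounded below is closed.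
  have hFWclosed : IsClosed (W.map f : Set (StandardModule A)) := by
    have : CompleteSpace W := hWclosed.completeSpace_coe
    have h1 : AntilipschitzWith ⟨C, hC⟩ (fun x : W => F x) :=
      AddMonoidHomClass.antilipschitz_of_bound (f ∘ₗ W.subtype) fun x => hbW x x.2
    have h2 := h1.isClosed_range
      (((F.restrictScalars ℂ).uniformContinuous).comp uniformContinuous_subtype_val)
    convert h2 using 1
    ext y
    constructor
    · rintro ⟨x, hx, rfl⟩
      exact ⟨⟨x, hx⟩, rfl⟩
    · rintro ⟨x, rfl⟩
      exact ⟨x, x.2, rfl⟩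
  refine ⟨hF, W, V.comap f, W.map f, V, ⟨hWclosed, hVclosed.preimage F.continuous, hFWclosed,
    hVclosed, hW, hV, ⟨E', fun x => rfl⟩, fun x hx => hx⟩,
    Submodule.fg_of_isCompl_of_sup_eq_top hW hP hWP,
    Submodule.fg_of_isCompl_of_sup_eq_top hV ((hP.map f).sup hU) ?_⟩
  -- `F(W) + F(P)` is the whole range of `F`, which `U` completes to `H_A`.
  rw [← sup_assoc, ← Submodule.map_sup, hWP, Submodule.map_top]
  exact hFU

theorem IsDiagonalDecomposition.range_sup {F : StandardModule A →L[A] StandardModule A}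
    {M₁ N₁ M₂ N₂ : Submodule A (StandardModule A)} (h : IsDiagonalDecomposition F M₁ N₁ M₂ N₂) :
    LinearMap.range (F : StandardModule A →ₗ[A] StandardModule A) ⊔ N₂ = ⊤ := by
  obtain ⟨F₁, hF₁⟩ := h.iso
  rw [eq_top_iff, ← h.isCompl_range.sup_eq_top]
  refine sup_le_sup_right (fun y hy => ⟨F₁.symm ⟨y, hy⟩, ?_⟩) _
  exact (hF₁ _).trans (by rw [F₁.apply_symm_apply])

end HilbertCStar

end

theorem corollary2p4 (A : Type*) [CStarAlgebra A] :
    HilbertCStar.fredholm A =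
      HilbertCStar.upperSemiFredholm A ∩ HilbertCStar.lowerSemiFredholm A := by
  apply Set.Subset.antisymm
  · rintro F ⟨hF, M₁, N₁, M₂, N₂, h, h₁, h₂⟩
    exact ⟨⟨hF, M₁, N₁, M₂, N₂, h, h₁⟩, ⟨hF, M₁, N₁, M₂, N₂, h, h₂⟩⟩
  · rintro F ⟨⟨hF, _, _, _, _, h, h₁⟩, ⟨_, _, _, _, _, h', h₂⟩⟩
    obtain ⟨n, C, hC, hb⟩ := h.exists_tail_bound h₁
    exact HilbertCStar.mem_fredholm_of_tail_bound hF hC hb h₂ h'.range_sup
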